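/- Let $K$ be a field and $S=K[x_1,\dots,x_5]$ with the standard grading. A $3$-uniform clutter $\mathcal C$ on $[5]=\{1,\dots,5\}$ is a set of $3$-element subsets of $[5]$, called circuits; its complement $\overline{\mathcal C}$ consists of the $3$-element subsets of $[5]$ that are not in $\mathcal C$, and its circuit ideal is $I(\mathcal C)=(\prod_{i\in F}x_i : F\in\mathcal C)\subseteq S$. A homogeneous ideal $I\ne 0$ of $S$ has a $d$-linear resolution if it is generated by homogeneous polynomials of degree $d$ and its graded Betti numbers (the numbers of summands $S(-j)$ in step $i$ of the minimal graded free resolution of $I$) satisfy $\beta_{i,j}(I)=0$ for all $i\ge 0$ and all $j\neq i+d$; it has a linear resolution if it has a $d$-linear resolution for some $d$. Let $\mathfrak T=\{\{1,2,4\},\{1,3,4\},\{2,3,4\},\{1,2,5\},\{1,3,5\},\{2,3,5\}\}$ be the hexahedron (the boundary of the triangular bipyramid over the triangle $123$ with apexes $4$ and $5$). Then: 1. $I(\overline{\mathfrak T})=(x_1x_4x_5,\;x_2x_4x_5,\;x_3x_4x_5,\;x_1x_2x_3)$, and this ideal does not have a linear resolution. 2. For every circuit $F\in\mathfrak T$,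 the ideal $I(\overline{\mathfrak T\setminus\{F\}})$ has a linear resolution, namely a $3$-linear resolution. -/

import Mathlib

/-- A clutter on the vertex set `V`: a set of subsets (the circuits), none of which contains
another one. -/
structure Clutter (V : Type*) where
  circuits : Finset (Finset V)
  antichain : ∀ e₁ ∈ circuits, ∀ e₂ ∈ circuits, e₁ ≠ e₂ → ¬ e₁ ⊆ e₂

namespace Clutter

/-- A clutter is `d`-uniform if every circuit has exactly `d` vertices. -/
def IsUniform {V : Type*} (C : Clutter V) (d : ℕ) : Prop :=
  ∀ F ∈ C.circuits, F.card = d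

/-- The complement of a `d`-uniform clutter: all `d`-subsets of the vertex set that are not
circuits. -/
def complement {V : Type*} [Fintype V] [DecidableEq V] (C : Clutter V) (d : ℕ) : Clutter V where
  circuits := Finset.powersetCard d Finset.univ \ C.circuits
  antichain := by
    intro e₁ h₁ e₂ h₂ hne hsub
    have c₁ := (Finset.mem_powersetCard.1 (Finset.mem_sdiff.1 h₁).1).2
    have c₂ := (Finset.mem_powersetCard.1 (Finset.mem_sdiff.1 h₂).1).2
    exact hne (Finset.eq_of_subset_of_card_le hsub (by omega))

/-- The clutter obtained by removing the circuit `F`. The vertex set is unchanged. -/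
def removeCircuit {V : Type*} [DecidableEq V] (C : Clutter V) (F : Finset V) : Clutter V where
  circuits := C.circuits.erase F
  antichain := fun e₁ h₁ e₂ h₂ =>
    C.antichain e₁ (Finset.mem_of_mem_erase h₁) e₂ (Finset.mem_of_mem_erase h₂)

/-- The ideal `I(C)` of `K[x_v : v ∈ V]` generated by the monomials `x_F = ∏_{v ∈ F} x_v`,
where `F` runs over the circuits of `C`. It is zero if `C` has no circuit. -/
noncomputable def circuitIdeal {V : Type*} (C : Clutter V) (K : Type*) [Field K] :
    Ideal (MvPolynomial V K) :=
  Ideal.span {m | ∃ F ∈ C.circuits, m = ∏ v ∈ F, MvPolynomial.X v}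

/-- The hexahedron (triangular bipyramid): the six triangles of the boundary of the bipyramid over
the triangle `1, 2, 3` with apexes `4` and `5`. The vertex with label `k` is `k - 1 : Fin 5`. -/
def hexahedron : Clutter (Fin 5) where
  circuits := {{0, 1, 3}, {0, 2, 3}, {1, 2, 3}, {0, 1, 4}, {0, 2, 4}, {1, 2, 4}}
  antichain := by decide

theorem hexahedron_isUniform : hexahedron.IsUniform 3 := by
  unfold IsUniform hexahedron
  decide

end Clutter

/-- An element `v = (v_b)_b` of the graded free module `⨁_b S(-deg b)`, `S = K[x_v : v ∈ V]` with
the standard grading, is homogeneous of degree `j`: each `v_b` is zero or a form of degree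
`j - deg b` (in particular it is zero if `j < deg b`). -/
def IsHomogeneousVector {V K ι : Type*} [Field K] (deg : ι → ℕ) (v : ι → MvPolynomial V K)
    (j : ℕ) : Prop :=
  ∀ b, ∀ m ∈ (v b).support, m.degree + deg b = j

/-- A minimal graded free resolution
`⋯ → F₂ → F₁ → F₀ → I → 0` of an ideal `I` of the standard graded polynomial ring
`S = K[x_v : v ∈ V]`. Here `F_i = ⨁_a S(-deg i a)` with `a` running over `Fin (rank i)`, the maps
are graded of degree zero, the sequence is exact, and `F_{i+1}` maps into `𝔪 F_i`, where `𝔪` is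
the ideal generated by the variables. -/
structure MinimalGradedFreeResolution {V K : Type*} [Field K] (I : Ideal (MvPolynomial V K)) where
  rank : ℕ → ℕ
  deg : (i : ℕ) → Fin (rank i) → ℕ
  /-- the surjection `F₀ → I`, as a map to `S` with image `I` -/
  aug : (Fin (rank 0) → MvPolynomial V K) →ₗ[MvPolynomial V K] MvPolynomial V K
  /-- the differentials `F_{i+1} → F_i` -/
  d : (i : ℕ) → (Fin (rank (i + 1)) → MvPolynomial V K) →ₗ[MvPolynomial V K]
    (Fin (rank i) → MvPolynomial V K)
  aug_homogeneous : ∀ a, (aug (Pi.single a 1)).IsHomogeneous (deg 0 a)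
  d_homogeneous : ∀ i a, IsHomogeneousVector (deg i) (d i (Pi.single a 1)) (deg (i + 1) a)
  range_aug : LinearMap.range aug = I
  exact_zero : Function.Exact (d 0) aug
  exact_succ : ∀ i, Function.Exact (d (i + 1)) (d i)
  minimal : ∀ i v b, d i v b ∈ Ideal.span (Set.range (MvPolynomial.X : V → MvPolynomial V K))

/-- The graded Betti number `β_{i,j}(I)`, read off from a minimal graded free resolution of `I`:
the number of summands `S(-j)` of `F_i`. It does not depend on the resolution, since minimal graded
free resolutions are unique up to isomorphism. -/
def MinimalGradedFreeResolution.betti {V K : Type*} [Field K] {I : Ideal (MvPolynomial V K)}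
    (F : MinimalGradedFreeResolution I) (i j : ℕ) : ℕ :=
  (Finset.univ.filter fun a => F.deg i a = j).card

/-- `I` has a `d`-linear resolution: `I` is generated by homogeneous polynomials of degree `d`, and
`β_{i,j}(I) = 0` for all `i` and all `j ≠ i + d`. -/
def HasLinearResolution {V K : Type*} [Field K] (d : ℕ) (I : Ideal (MvPolynomial V K)) : Prop :=
  (∃ G : Set (MvPolynomial V K), (∀ g ∈ G, g.IsHomogeneous d) ∧ I = Ideal.span G) ∧
  ∃ F : MinimalGradedFreeResolution I, ∀ i j, j ≠ i + d → F.betti i j = 0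

/-!
If `I` has a `d`-linear resolution, `g` is a form of degree `d` and `I : g` has a `1`-linear
resolution, then multiplication by `g` lifts to a chain map between the two resolutions, whose
mapping cone is a `d`-linear resolution of `I + (g)`. Hence an ideal generated by forms of degree
`d` with linear quotients has a `d`-linear resolution. With the circuit `F` restored, the
monomials `x₁x₄x₅, x₂x₄x₅, x₃x₄x₅, x_F, x₁x₂x₃` have linear quotients in this order.

Conversely, suppose that `J + (g)` has a `d`-linear resolution, where `g ∉ J` and `J` contains a
form `f ≠ 0` of degree `d`. The coefficient of `g` in a linear syzygy is a linear form in `J : g`.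
As the linear syzygies generate all syzygies, among them the Koszul syzygy of `f` and `g`, some
such coefficient is nonzero. For `J = (x₁x₄x₅, x₂x₄x₅, x₃x₄x₅)` and `g = x₁x₂x₃`, however,
`J : g = (x₄x₅)` contains no linear form.
-/

open MvPolynomial Matrix

section Homogeneous

variable {V R : Type*}

theorem homogeneousComponent_add_mul [CommSemiring R] {p : MvPolynomial V R} {m : ℕ}
    (hp : p.IsHomogeneous m) (n : ℕ) (q : MvPolynomial V R) :
    homogeneousComponent (m + n) (p * q) = p * homogeneousComponent n q := by
  let := gradedAlgebra (σ := V) (R := R)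
  have hcomp (r : MvPolynomial V R) (k : ℕ) :
      (DirectSum.decompose (homogeneousSubmodule V R) r k : MvPolynomial V R) =
        homogeneousComponent k r := decomposition.decompose'_apply r k
  rw [← hcomp, ← hcomp, DirectSum.coe_decompose_mul_add_of_left_mem _ hp]

theorem homogeneousComponent_mul_of_isHomogeneous [CommSemiring R] {p : MvPolynomial V R} {m : ℕ}
    (hp : p.IsHomogeneous m) (q : MvPolynomial V R) :
    homogeneousComponent m (q * p) = C (constantCoeff q) * p := by
  rw [mul_comm q, ← add_zero m, homogeneousComponent_add_mul hp, homogeneousComponent_zero,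
    mul_comm, constantCoeff_eq]

theorem mem_pow_idealOfVars_of_isHomogeneous [CommSemiring R] {p : MvPolynomial V R} {n : ℕ}
    (hp : p.IsHomogeneous n) : p ∈ idealOfVars V R ^ n :=
  (mem_pow_idealOfVars_iff' n p).2 fun _ hm => hp.coeff_eq_zero hm.ne

theorem eq_zero_of_isHomogeneous_of_mem_pow_idealOfVars [CommSemiring R] {p : MvPolynomial V R}
    {m n : ℕ} (hp : p.IsHomogeneous m) (hmem : p ∈ idealOfVars V R ^ n) (hmn : m < n) : p = 0 := by
  ext s
  by_cases hs : s.degree = m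
  · exact (mem_pow_idealOfVars_iff' n p).1 hmem s (hs ▸ hmn)
  · exact hp.coeff_eq_zero hs

end Homogeneous

section HomogeneousMatrix

variable {V R l m n o : Type*} [CommRing R]

/-- A matrix of forms of degree `k`; zero entries are allowed. -/
def IsHomogeneousMatrix (M : Matrix m n (MvPolynomial V R)) (k : ℕ) : Prop :=
  ∀ i j, (M i j).IsHomogeneous k

namespace IsHomogeneousMatrix

variable {M : Matrix l m (MvPolynomial V R)} {j k : ℕ}

theorem zero (k : ℕ) : IsHomogeneousMatrix (0 : Matrix m n (MvPolynomial V R)) k :=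
  fun _ _ => isHomogeneous_zero _ _ _

theorem neg (hM : IsHomogeneousMatrix M k) : IsHomogeneousMatrix (-M) k :=
  fun a b => (hM a b).neg

theorem fromCols {N : Matrix l n (MvPolynomial V R)} (hM : IsHomogeneousMatrix M k)
    (hN : IsHomogeneousMatrix N k) : IsHomogeneousMatrix (Matrix.fromCols M N) k :=
  fun a b => b.casesOn (hM a) (hN a)

theorem fromBlocks {N : Matrix l n (MvPolynomial V R)} {M' : Matrix o m (MvPolynomial V R)}
    {N' : Matrix o n (MvPolynomial V R)} (hM : IsHomogeneousMatrix M k)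
    (hN : IsHomogeneousMatrix N k) (hM' : IsHomogeneousMatrix M' k)
    (hN' : IsHomogeneousMatrix N' k) : IsHomogeneousMatrix (Matrix.fromBlocks M N M' N') k :=
  fun a b => a.casesOn (fun a => b.casesOn (hM a) (hN a)) (fun a => b.casesOn (hM' a) (hN' a))

variable [Fintype m]

theorem mul {N : Matrix m n (MvPolynomial V R)} (hM : IsHomogeneousMatrix M j)
    (hN : IsHomogeneousMatrix N k) : IsHomogeneousMatrix (M * N) (j + k) :=
  fun a b => IsHomogeneous.sum _ _ _ fun c _ => (hM a c).mul (hN c b)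

theorem mulVec_mem_pow_idealOfVars (hM : IsHomogeneousMatrix M k) (v : m → MvPolynomial V R)
    (a : l) : (M *ᵥ v) a ∈ idealOfVars V R ^ k :=
  Ideal.sum_mem _ fun b _ =>
    Ideal.mul_mem_right _ _ (mem_pow_idealOfVars_of_isHomogeneous (hM a b))

theorem mulVec_homogeneousComponent (hM : IsHomogeneousMatrix M j) (k : ℕ)
    (v : m → MvPolynomial V R) (a : l) :
    (M *ᵥ fun b => homogeneousComponent k (v b)) a = homogeneousComponent (j + k) ((M *ᵥ v) a) := by
  simp only [mulVec, dotProduct, map_sum, homogeneousComponent_add_mul (hM _ _)]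

theorem exists_mul_eq [Fintype n] {N : Matrix l n (MvPolynomial V R)}
    (hM : IsHomogeneousMatrix M j) (hN : IsHomogeneousMatrix N (j + k))
    (hrange : LinearMap.range N.mulVecLin ≤ LinearMap.range M.mulVecLin) :
    ∃ P : Matrix m n (MvPolynomial V R), IsHomogeneousMatrix P k ∧ M * P = N := by
  classical
  choose v hv using fun b => hrange ⟨Pi.single b 1, rfl⟩
  refine ⟨of fun a b => homogeneousComponent k (v b a),
    fun a b => homogeneousComponent_isHomogeneous _ _, Matrix.ext fun a b => ?_⟩
  calc (M *ᵥ fun c => homogeneousComponent k (v b c)) a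
      = homogeneousComponent (j + k) ((M *ᵥ v b) a) := hM.mulVec_homogeneousComponent k _ a
    _ = homogeneousComponent (j + k) (N a b) := by
      rw [← mulVecLin_apply, hv, mulVecLin_apply, mulVec_single_one, col_apply]
    _ = N a b := homogeneousComponent_eq_self (hN a b)

end IsHomogeneousMatrix

end HomogeneousMatrix

section ConeExactness

variable {R α₀ α₁ α₂ β₀ β₁ β₂ : Type*} [CommRing R] [Fintype α₁] [Fintype α₂] [Fintype β₁]
  [Fintype β₂] {A₀ : Matrix α₀ α₁ R} {A₁ : Matrix α₁ α₂ R} {B₀ : Matrix β₀ β₁ R}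
  {B₁ : Matrix β₁ β₂ R} {f₀ : Matrix α₀ β₁ R} {f₁ : Matrix α₁ β₂ R}

theorem mem_range_fromBlocks_iff (hA : Function.Exact A₁.mulVecLin A₀.mulVecLin)
    (hf : A₀ * f₁ = f₀ * B₁) (v : α₁ ⊕ β₁ → R) :
    v ∈ LinearMap.range (fromBlocks A₁ f₁ 0 (-B₁)).mulVecLin ↔
      fromCols A₀ f₀ *ᵥ v = 0 ∧ v ∘ Sum.inr ∈ LinearMap.range B₁.mulVecLin := by
  obtain ⟨x, y, rfl⟩ : ∃ x y, v = Sum.elim x y := ⟨_, _, (Sum.elim_comp_inl_inr v).symm⟩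
  have hf' (z : β₂ → R) : A₀ *ᵥ (f₁ *ᵥ z) = f₀ *ᵥ (B₁ *ᵥ z) := by
    rw [mulVec_mulVec, hf, mulVec_mulVec]
  simp only [fromCols_mulVec_sumElim, Sum.elim_comp_inr, LinearMap.mem_range, mulVecLin_apply,
    fromBlocks_mulVec, zero_mulVec, zero_add, neg_mulVec]
  constructor
  · rintro ⟨w, hw⟩
    obtain ⟨rfl, rfl⟩ := Sum.elim_eq_iff.1 hw
    have hAA : A₀ *ᵥ (A₁ *ᵥ (w ∘ Sum.inl)) = 0 := hA.apply_apply_eq_zero _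
    refine ⟨?_, -(w ∘ Sum.inr), mulVec_neg _ _⟩
    rw [mulVec_add, hAA, hf', mulVec_neg, zero_add, add_neg_cancel]
  · rintro ⟨hxy, z, rfl⟩
    obtain ⟨w, hw⟩ := (hA (x + f₁ *ᵥ z)).1 (by rw [mulVecLin_apply, mulVec_add, hf', hxy])
    rw [mulVecLin_apply] at hw
    exact ⟨Sum.elim w (-z), by simp [mulVec_neg, hw]⟩

theorem exact_fromBlocks_fromCols (hA : Function.Exact A₁.mulVecLin A₀.mulVecLin)
    (hB : ∀ y, y ∈ LinearMap.range B₁.mulVecLin ↔ f₀ *ᵥ y ∈ LinearMap.range A₀.mulVecLin)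
    (hf : A₀ * f₁ = f₀ * B₁) :
    Function.Exact (fromBlocks A₁ f₁ 0 (-B₁)).mulVecLin (fromCols A₀ f₀).mulVecLin := by
  intro v
  rw [← LinearMap.coe_range, SetLike.mem_coe, mem_range_fromBlocks_iff hA hf, mulVecLin_apply,
    iff_self_and, hB, fromCols_mulVec]
  refine fun hv => ⟨-(v ∘ Sum.inl), ?_⟩
  rw [mulVecLin_apply, mulVec_neg, neg_eq_of_add_eq_zero_right hv]

theorem exact_fromBlocks_fromBlocks (hA : Function.Exact A₁.mulVecLin A₀.mulVecLin)
    (hB : Function.Exact B₁.mulVecLin B₀.mulVecLin) (hf : A₀ * f₁ = f₀ * B₁) :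
    Function.Exact (fromBlocks A₁ f₁ 0 (-B₁)).mulVecLin (fromBlocks A₀ f₀ 0 (-B₀)).mulVecLin := by
  intro v
  have hker : (fromBlocks A₀ f₀ 0 (-B₀)) *ᵥ v = 0 ↔
      fromCols A₀ f₀ *ᵥ v = 0 ∧ B₀ *ᵥ (v ∘ Sum.inr) = 0 := by
    rw [fromBlocks_mulVec, fromCols_mulVec, ← Sum.elim_zero_zero, Sum.elim_eq_iff]
    simp only [zero_mulVec, zero_add, neg_mulVec, neg_eq_zero]
  rw [← LinearMap.coe_range, SetLike.mem_coe, mem_range_fromBlocks_iff hA hf, mulVecLin_apply,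
    hker, LinearMap.mem_range]
  exact and_congr_right' (hB _)

end ConeExactness

/-- A `d`-linear graded free resolution `⋯ → F₁ → F₀ → S → S/I → 0` of `S/I`, where
`S = R[x_v : v ∈ V]` and `F_i` is a sum of copies of `S(-i-d)`, given by the matrices of its maps.
The complex is indexed so that `ι 0` indexes the basis of `S` and `ι (i + 1)` that of `F_i`;
the entries of `diff 0` are thus forms of degree `d` generating `I`, and those of all later matrices
are linear forms. -/
structure LinearResolution {V R : Type*} [CommRing R] (d : ℕ) (I : Ideal (MvPolynomial V R)) where
  ι : ℕ → Type
  [fintype : ∀ i, Fintype (ι i)]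
  [unique : Unique (ι 0)]
  diff : ∀ i, Matrix (ι i) (ι (i + 1)) (MvPolynomial V R)
  diff_zero_homogeneous : IsHomogeneousMatrix (diff 0) d
  diff_succ_homogeneous : ∀ i, IsHomogeneousMatrix (diff (i + 1)) 1
  span_range_diff_zero : Ideal.span (Set.range (diff 0 default)) = I
  exact_diff : ∀ i, Function.Exact (diff (i + 1)).mulVecLin (diff i).mulVecLin

namespace LinearResolution

attribute [instance] fintype unique

section MappingCone

variable {V R : Type*} [CommRing R] {d : ℕ} {I : Ideal (MvPolynomial V R)}

theorem mem_range_diff_zero (F : LinearResolution d I) (v : F.ι 0 → MvPolynomial V R) :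
    v ∈ LinearMap.range (F.diff 0).mulVecLin ↔ v default ∈ I := by
  rw [← SetLike.ext_iff.1 F.span_range_diff_zero, Ideal.mem_span_range_iff_exists_fun,
    LinearMap.mem_range]
  refine exists_congr fun c => ?_
  rw [mulVecLin_apply, funext_iff, Unique.forall_iff, mulVec, dotProduct]
  simp only [mul_comm]

/-- The resolution of the zero ideal by `F_i = 0`. -/
noncomputable def bot (d : ℕ) : LinearResolution d (⊥ : Ideal (MvPolynomial V R)) where
  ι
    | 0 => Unit
    | _ + 1 => Empty
  fintype
    | 0 => inferInstanceAs (Fintype Unit)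
    | _ + 1 => inferInstanceAs (Fintype Empty)
  unique := inferInstanceAs (Unique Unit)
  diff _ := 0
  diff_zero_homogeneous := .zero d
  diff_succ_homogeneous _ := .zero 1
  span_range_diff_zero := by
    rw [Set.range_eq_empty_iff.2 inferInstance, Ideal.span_empty]
  exact_diff
    | 0 => fun v => by simp [Subsingleton.elim v 0]
    | _ + 1 => fun v => by simp [Subsingleton.elim v 0]

variable {g : MvPolynomial V R}

theorem diff_homogeneous_one {J : Ideal (MvPolynomial V R)} (G : LinearResolution 1 J) :
    ∀ i, IsHomogeneousMatrix (G.diff i) 1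
  | 0 => G.diff_zero_homogeneous
  | i + 1 => G.diff_succ_homogeneous i

theorem mem_range_diff_zero_colon_iff (F : LinearResolution d I)
    (G : LinearResolution 1 (I.colon {g})) (y : G.ι 0 → MvPolynomial V R) :
    y ∈ LinearMap.range (G.diff 0).mulVecLin ↔
      (of fun _ _ => g : Matrix (F.ι 0) (G.ι 0) _) *ᵥ y ∈ LinearMap.range (F.diff 0).mulVecLin := by
  rw [G.mem_range_diff_zero, F.mem_range_diff_zero, Submodule.mem_colon_singleton, smul_eq_mul,
    mulVec, dotProduct, Fintype.sum_unique, of_apply, mul_comm]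

/-- The condition on the `i`-th component `f` of a chain map between linear resolutions under which
the next component can be constructed: `f` has the degree of `F.diff i`, and `f * G.diff i` lifts
through `F.diff i`. -/
def IsLiftable {J : Ideal (MvPolynomial V R)} (F : LinearResolution d I) (G : LinearResolution 1 J)
    (i : ℕ) (f : Matrix (F.ι i) (G.ι i) (MvPolynomial V R)) : Prop :=
  (∃ k, IsHomogeneousMatrix (F.diff i) k ∧ IsHomogeneousMatrix f k) ∧
    LinearMap.range (f * G.diff i).mulVecLin ≤ LinearMap.range (F.diff i).mulVecLin

theorem isLiftable_zero (F : LinearResolution d I) (G : LinearResolution 1 (I.colon {g}))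
    (hg : g.IsHomogeneous d) : IsLiftable F G 0 (of fun _ _ => g) := by
  refine ⟨⟨d, F.diff_zero_homogeneous, fun _ _ => hg⟩, ?_⟩
  rintro _ ⟨v, rfl⟩
  rw [mulVecLin_apply, ← mulVec_mulVec, ← mem_range_diff_zero_colon_iff]
  exact LinearMap.mem_range_self _ v

theorem IsLiftable.exists_next {J : Ideal (MvPolynomial V R)} {F : LinearResolution d I}
    {G : LinearResolution 1 J} {i : ℕ} {f : Matrix (F.ι i) (G.ι i) (MvPolynomial V R)}
    (hf : IsLiftable F G i f) :
    ∃ f' : Matrix (F.ι (i + 1)) (G.ι (i + 1)) (MvPolynomial V R),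
      F.diff i * f' = f * G.diff i ∧ IsHomogeneousMatrix f' 1 ∧ IsLiftable F G (i + 1) f' := by
  obtain ⟨⟨k, hFk, hfk⟩, hrange⟩ := hf
  obtain ⟨f', hf'1, hf'⟩ := hFk.exists_mul_eq (hfk.mul (G.diff_homogeneous_one i)) hrange
  refine ⟨f', hf', hf'1, ⟨1, F.diff_succ_homogeneous i, hf'1⟩, ?_⟩
  rintro _ ⟨v, rfl⟩
  refine (F.exact_diff i _).1 ?_
  calc F.diff i *ᵥ (f' * G.diff (i + 1)) *ᵥ v
      = f *ᵥ G.diff i *ᵥ G.diff (i + 1) *ᵥ v := by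
        rw [← mulVec_mulVec, mulVec_mulVec, hf', ← mulVec_mulVec]
    _ = 0 := by
        rw [← mulVecLin_apply (G.diff i), ← mulVecLin_apply (G.diff (i + 1)),
          (G.exact_diff i).apply_apply_eq_zero, mulVec_zero]

theorem exists_chainMap (F : LinearResolution d I) (G : LinearResolution 1 (I.colon {g}))
    (hg : g.IsHomogeneous d) :
    ∃ f : ∀ i, Matrix (F.ι i) (G.ι i) (MvPolynomial V R),
      f 0 = of (fun _ _ => g) ∧ (∀ i, IsHomogeneousMatrix (f (i + 1)) 1) ∧
        ∀ i, F.diff i * f (i + 1) = f i * G.diff i := by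
  choose! next hcomm hhom hlift using fun i f (hf : IsLiftable F G i f) => hf.exists_next
  let f : ∀ i, Matrix (F.ι i) (G.ι i) (MvPolynomial V R) := Nat.rec (of fun _ _ => g) next
  have hf (i : ℕ) : IsLiftable F G i (f i) := by
    induction i with
    | zero => exact isLiftable_zero F G hg
    | succ i ih => exact hlift i (f i) ih
  exact ⟨f, rfl, fun i => hhom i (f i) (hf i), fun i => hcomm i (f i) (hf i)⟩

/-- The index types of the mapping cone of a map from the complex `β` to the complex `α`, where
`β` is shifted by one place. -/
def ConeIndex (α β : ℕ → Type) : ℕ → Type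
  | 0 => α 0
  | i + 1 => α (i + 1) ⊕ β i

/-- The matrices of the mapping cone of a chain map `f` from the complex `B` to the complex `A`. -/
def coneDiff {S : Type*} [Ring S] {α β : ℕ → Type} (A : ∀ i, Matrix (α i) (α (i + 1)) S)
    (B : ∀ i, Matrix (β i) (β (i + 1)) S) (f : ∀ i, Matrix (α i) (β i) S) :
    ∀ i, Matrix (ConeIndex α β i) (ConeIndex α β (i + 1)) S
  | 0 => fromCols (A 0) (f 0)
  | i + 1 => fromBlocks (A (i + 1)) (f (i + 1)) 0 (-B i)

/-- The mapping cone of a chain map from `G` to `F` which starts with multiplication by `g`. -/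
noncomputable def cone (F : LinearResolution d I) (G : LinearResolution 1 (I.colon {g}))
    (f : ∀ i, Matrix (F.ι i) (G.ι i) (MvPolynomial V R)) (hg : g.IsHomogeneous d)
    (hf₀ : f 0 = of fun _ _ => g) (hf₁ : ∀ i, IsHomogeneousMatrix (f (i + 1)) 1)
    (hf : ∀ i, F.diff i * f (i + 1) = f i * G.diff i) :
    LinearResolution d (I ⊔ Ideal.span {g}) where
  ι := ConeIndex F.ι G.ι
  fintype
    | 0 => F.fintype 0
    | i + 1 => instFintypeSum (F.ι (i + 1)) (G.ι i)
  unique := F.unique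
  diff := coneDiff F.diff G.diff f
  diff_zero_homogeneous := by
    refine F.diff_zero_homogeneous.fromCols ?_
    rw [hf₀]
    exact fun _ _ => hg
  diff_succ_homogeneous i := (F.diff_succ_homogeneous i).fromBlocks (hf₁ i) (.zero 1)
    (G.diff_homogeneous_one i).neg
  span_range_diff_zero := by
    have h : f 0 default = fun _ => g := by
      rw [hf₀]
      rfl
    change Ideal.span (Set.range (Sum.elim (F.diff 0 default) (f 0 default))) = _
    rw [Set.Sum.elim_range, Ideal.span_union, F.span_range_diff_zero, h, Set.range_const]
  exact_diff
    | 0 => by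
      refine exact_fromBlocks_fromCols (F.exact_diff 0) ?_ (hf 0)
      rw [hf₀]
      exact mem_range_diff_zero_colon_iff F G
    | i + 1 => exact_fromBlocks_fromBlocks (F.exact_diff (i + 1)) (G.exact_diff i) (hf (i + 1))

theorem nonempty_sup_span_singleton (F : LinearResolution d I)
    (G : LinearResolution 1 (I.colon {g})) (hg : g.IsHomogeneous d) :
    Nonempty (LinearResolution d (I ⊔ Ideal.span {g})) := by
  obtain ⟨f, hf₀, hf₁, hf⟩ := exists_chainMap F G hg
  exact ⟨cone F G f hg hf₀ hf₁ hf⟩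

end MappingCone

section Minimal

variable {V K : Type*} [Field K] {d : ℕ} {I : Ideal (MvPolynomial V K)}

/-- The numbering of the basis indexed by `F.ι i`, as an isomorphism of free modules. -/
noncomputable def basisEquiv (F : LinearResolution d I) (i : ℕ) :
    (F.ι i → MvPolynomial V K) ≃ₗ[MvPolynomial V K]
      (Fin (Fintype.card (F.ι i)) → MvPolynomial V K) :=
  .funCongrLeft _ _ (Fintype.equivFin (F.ι i)).symm

theorem mulVec_basisEquiv_symm_single_isHomogeneous (F : LinearResolution d I) {i k : ℕ}
    (hk : IsHomogeneousMatrix (F.diff i) k) (a : Fin (Fintype.card (F.ι (i + 1)))) (b : F.ι i) :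
    ((F.diff i *ᵥ (F.basisEquiv (i + 1)).symm (Pi.single a 1)) b).IsHomogeneous k := by
  classical
  have h : (F.basisEquiv (i + 1)).symm (Pi.single a 1) =
      Pi.single ((Fintype.equivFin (F.ι (i + 1))).symm a) 1 :=
    Pi.single_comp_equiv (Fintype.equivFin (F.ι (i + 1))) a 1
  rw [h, mulVec_single_one]
  exact hk _ _

/-- The minimal graded free resolution of `I` obtained from a linear resolution of `S/I` by
numbering the bases and removing the term `S`. -/
noncomputable def toMinimalGradedFreeResolution (F : LinearResolution d I) :
    MinimalGradedFreeResolution I where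
  rank i := Fintype.card (F.ι (i + 1))
  deg i _ := i + d
  aug := (LinearEquiv.funUnique (F.ι 0) _ _).toLinearMap ∘ₗ (F.diff 0).mulVecLin ∘ₗ
    (F.basisEquiv 1).symm.toLinearMap
  d i := (F.basisEquiv (i + 1)).toLinearMap ∘ₗ (F.diff (i + 1)).mulVecLin ∘ₗ
    (F.basisEquiv (i + 2)).symm.toLinearMap
  aug_homogeneous a := by
    rw [zero_add d]
    exact F.mulVec_basisEquiv_symm_single_isHomogeneous F.diff_zero_homogeneous a default
  d_homogeneous i a b m hm := by
    have h := (F.mulVec_basisEquiv_symm_single_isHomogeneous (F.diff_succ_homogeneous i) a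
      _).degree_eq_sum_deg_support hm
    rw [Finsupp.degree_apply, ← h, ← add_assoc, add_comm 1 i]
  range_aug := by
    ext f
    constructor
    · rintro ⟨v, rfl⟩
      exact (F.mem_range_diff_zero _).1 (LinearMap.mem_range_self _ _)
    · intro hf
      obtain ⟨v, hv⟩ := (F.mem_range_diff_zero fun _ => f).2 hf
      exact ⟨F.basisEquiv 1 v, by simp [hv]⟩
  exact_zero := .of_ladder_linearEquiv_of_exact (e₁ := F.basisEquiv 2) (e₂ := F.basisEquiv 1)
    (e₃ := LinearEquiv.funUnique (F.ι 0) _ _) (by ext; simp) (by ext; simp) (F.exact_diff 0)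
  exact_succ i := .of_ladder_linearEquiv_of_exact (e₁ := F.basisEquiv (i + 3))
    (e₂ := F.basisEquiv (i + 2)) (e₃ := F.basisEquiv (i + 1)) (by ext; simp) (by ext; simp)
    (F.exact_diff (i + 1))
  minimal i v b := by
    have h := (F.diff_succ_homogeneous i).mulVec_mem_pow_idealOfVars ((F.basisEquiv (i + 2)).symm v)
      ((Fintype.equivFin (F.ι (i + 1))).symm b)
    rwa [pow_one] at h

theorem hasLinearResolution (F : LinearResolution d I) : HasLinearResolution d I := by
  refine ⟨⟨_, ?_, F.span_range_diff_zero.symm⟩, F.toMinimalGradedFreeResolution, fun i j hj => ?_⟩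
  · rintro _ ⟨b, rfl⟩
    exact F.diff_zero_homogeneous _ _
  · exact Finset.card_eq_zero.2 (Finset.filter_eq_empty_iff.2 fun a _ => hj.symm)

end Minimal

end LinearResolution

section EdgeIdeal

variable {V : Type*} (R : Type*) [CommRing R]

/-- The squarefree monomial ideal generated by the products `∏ v ∈ F, X v` with `F ∈ E`: the edge
ideal of the hypergraph with edge set `E`. -/
noncomputable def edgeIdeal (E : Set (Finset V)) : Ideal (MvPolynomial V R) :=
  Ideal.span ((fun F => ∏ v ∈ F, X v) '' E)

variable {R} {E E' : Set (Finset V)}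

theorem subset_support_iff_sum_single_le {F : Finset V} {m : V →₀ ℕ} :
    ∑ v ∈ F, Finsupp.single v 1 ≤ m ↔ F ⊆ m.support := by
  classical
  simp only [Finsupp.le_def, Finsupp.finsetSum_apply, Finsupp.single_apply, Finset.sum_ite_eq',
    Finset.subset_iff, Finsupp.mem_support_iff]
  refine forall_congr' fun v => ?_
  split_ifs with hv <;> simp [hv, Nat.one_le_iff_ne_zero]

theorem prod_X_eq_monomial (F : Finset V) :
    ∏ v ∈ F, (X v : MvPolynomial V R) = monomial (∑ v ∈ F, Finsupp.single v 1) 1 :=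
  (monomial_sum_one F _).symm

theorem prod_X_isHomogeneous (F : Finset V) :
    (∏ v ∈ F, X v : MvPolynomial V R).IsHomogeneous F.card := by
  simpa using IsHomogeneous.prod F _ (fun _ => 1) fun v _ => isHomogeneous_X R v

theorem prod_X_ne_zero [Nontrivial R] (F : Finset V) :
    ∏ v ∈ F, (X v : MvPolynomial V R) ≠ 0 := by
  rw [prod_X_eq_monomial, Ne, monomial_eq_zero]
  exact one_ne_zero

theorem mem_edgeIdeal_iff {f : MvPolynomial V R} :
    f ∈ edgeIdeal R E ↔ ∀ m ∈ f.support, ∃ F ∈ E, F ⊆ m.support := by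
  have hgen : (fun F : Finset V => ∏ v ∈ F, (X v : MvPolynomial V R)) =
      (fun s => monomial s 1) ∘ fun F => ∑ v ∈ F, Finsupp.single v 1 :=
    funext prod_X_eq_monomial
  rw [edgeIdeal, hgen, Set.image_comp, mem_ideal_span_monomial_image]
  simp only [Set.exists_mem_image, subset_support_iff_sum_single_le]

theorem edgeIdeal_mono_of_exists_subset (h : ∀ F ∈ E, ∃ F' ∈ E', F' ⊆ F) :
    edgeIdeal R E ≤ edgeIdeal R E' := by
  refine Ideal.span_le.2 (Set.forall_mem_image.2 fun F hF => ?_)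
  obtain ⟨F', hF', hsub⟩ := h F hF
  exact Ideal.mem_of_dvd _ (Finset.prod_dvd_prod_of_subset _ _ _ hsub)
    (Ideal.subset_span (Set.mem_image_of_mem _ hF'))

theorem edgeIdeal_insert (G : Finset V) :
    edgeIdeal R (insert G E) = edgeIdeal R E ⊔ Ideal.span {∏ v ∈ G, X v} := by
  rw [edgeIdeal, Set.image_insert_eq, Ideal.span_insert, sup_comm, edgeIdeal]

theorem edgeIdeal_colon_prod_X [DecidableEq V] (E : Set (Finset V)) (G : Finset V) :
    (edgeIdeal R E).colon {∏ v ∈ G, X v} = edgeIdeal R ((· \ G) '' E) := by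
  refine le_antisymm (fun f hf => mem_edgeIdeal_iff.2 fun m hm => ?_)
    (Ideal.span_le.2 (Set.forall_mem_image.2 (Set.forall_mem_image.2 fun F hF => ?_)))
  · rw [Submodule.mem_colon_singleton, smul_eq_mul, prod_X_eq_monomial, mem_edgeIdeal_iff] at hf
    have hmG : m + ∑ v ∈ G, Finsupp.single v 1 ∈
        (f * monomial (∑ v ∈ G, Finsupp.single v 1) 1).support := by
      rwa [mem_support_iff, coeff_mul_monomial, mul_one, ← mem_support_iff]
    obtain ⟨F, hF, hsub⟩ := hf _ hmG
    refine ⟨F \ G, Set.mem_image_of_mem _ hF, fun v hv => ?_⟩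
    obtain ⟨hvF, hvG⟩ := Finset.mem_sdiff.1 hv
    simpa [Finsupp.single_apply, hvG] using hsub hvF
  · rw [SetLike.mem_coe, Submodule.mem_colon_singleton, smul_eq_mul,
      ← Finset.prod_union Finset.sdiff_disjoint, Finset.sdiff_union_self_eq_union]
    exact Ideal.mem_of_dvd _ (Finset.prod_dvd_prod_of_subset _ _ _ Finset.subset_union_left)
      (Ideal.subset_span (Set.mem_image_of_mem _ hF))

theorem edgeIdeal_image_singleton_preimage (h : ∀ F ∈ E, ∃ v ∈ F, {v} ∈ E) :
    edgeIdeal R (singleton '' (singleton ⁻¹' E)) = edgeIdeal R E := by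
  refine le_antisymm (edgeIdeal_mono_of_exists_subset fun F hF =>
    ⟨F, Set.image_preimage_subset _ _ hF, subset_rfl⟩)
    (edgeIdeal_mono_of_exists_subset fun F hF => ?_)
  obtain ⟨v, hv, hvE⟩ := h F hF
  exact ⟨{v}, Set.mem_image_of_mem _ hvE, Finset.singleton_subset_iff.2 hv⟩

end EdgeIdeal

section LinearQuotients

variable {V R : Type*} [CommRing R]

theorem LinearResolution.nonempty_edgeIdeal_image_singleton {s : Set V} (hs : s.Finite) :
    Nonempty (LinearResolution 1 (edgeIdeal R (singleton '' s))) := by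
  classical
  induction s, hs using Set.Finite.induction_on with
  | empty =>
    rw [Set.image_empty, edgeIdeal, Set.image_empty, Ideal.span_empty]
    exact ⟨.bot 1⟩
  | @insert v s hv _ ih =>
    obtain ⟨F⟩ := ih
    have hcolon : (edgeIdeal R (singleton '' s)).colon {∏ u ∈ {v}, X u} =
        edgeIdeal R (singleton '' s) := by
      have hdiff : ∀ u ∈ s, ({u} \ {v} : Finset V) = {u} := fun u hu =>
        Finset.sdiff_eq_self_of_disjoint
          (Finset.disjoint_singleton.2 (ne_of_mem_of_not_mem hu hv))
      rw [edgeIdeal_colon_prod_X, Set.image_image, Set.image_congr hdiff]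
    rw [Set.image_insert_eq, edgeIdeal_insert]
    refine F.nonempty_sup_span_singleton ?_ (by simpa using prod_X_isHomogeneous {v})
    rwa [hcolon]

variable [DecidableEq V]

/-- The squarefree monomials `x_F`, for `F` running backwards through the list, have linear
quotients: for every decomposition into `G :: L` of a final segment of the list, the ideal
`(x_F : F ∈ L) : x_G` is generated by variables. -/
def HasLinearQuotients : List (Finset V) → Prop
  | [] => True
  | G :: L => HasLinearQuotients L ∧ ∀ F ∈ L, ∃ v ∈ F, ∃ F' ∈ L, F' \ G = {v}

instance HasLinearQuotients.decidable : DecidablePred (HasLinearQuotients (V := V))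
  | [] => inferInstanceAs (Decidable True)
  | _ :: L =>
    have := HasLinearQuotients.decidable L
    inferInstanceAs (Decidable (_ ∧ _))

theorem HasLinearQuotients.nonempty_linearResolution {d : ℕ} :
    ∀ {L : List (Finset V)}, HasLinearQuotients L → (∀ F ∈ L, F.card = d) →
      Nonempty (LinearResolution d (edgeIdeal R {F | F ∈ L}))
  | [], _, _ => by
    simp only [List.not_mem_nil, Set.ofPred_false, edgeIdeal, Set.image_empty, Ideal.span_empty]
    exact ⟨.bot d⟩
  | G :: L, ⟨hL, hG⟩, hcard => by
    rw [List.forall_mem_cons] at hcard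
    obtain ⟨F⟩ := hL.nonempty_linearResolution hcard.2
    have hvars : ∀ A ∈ (· \ G) '' {F | F ∈ L}, ∃ v ∈ A, {v} ∈ (· \ G) '' {F | F ∈ L} := by
      refine Set.forall_mem_image.2 fun A hA => ?_
      obtain ⟨v, hvA, F', hF', hv⟩ := hG A hA
      refine ⟨v, Finset.mem_sdiff.2 ⟨hvA, ?_⟩, F', hF', hv⟩
      exact (Finset.mem_sdiff.1 (hv ▸ Finset.mem_singleton_self v)).2
    have hfin : (singleton ⁻¹' ((· \ G) '' {F | F ∈ L}) : Set V).Finite :=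
      ((List.finite_toSet L).image _).preimage Finset.singleton_injective.injOn
    obtain ⟨G'⟩ := LinearResolution.nonempty_edgeIdeal_image_singleton (R := R) hfin
    rw [edgeIdeal_image_singleton_preimage hvars, ← edgeIdeal_colon_prod_X] at G'
    have hinsert : {F | F ∈ G :: L} = insert G {F | F ∈ L} := Set.ext fun F => List.mem_cons
    rw [hinsert, edgeIdeal_insert]
    exact F.nonempty_sup_span_singleton G' (hcard.1 ▸ prod_X_isHomogeneous G)

end LinearQuotients

section NonlinearResolution

variable {V R : Type*} [CommRing R]

theorem span_eq_bot_of_isHomogeneous_of_lt {s t : Set (MvPolynomial V R)} {m n : ℕ}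
    (hs : ∀ f ∈ s, f.IsHomogeneous m) (ht : ∀ f ∈ t, f.IsHomogeneous n)
    (hst : Ideal.span s = Ideal.span t) (hmn : m < n) : Ideal.span s = ⊥ := by
  have hpow : Ideal.span t ≤ idealOfVars V R ^ n :=
    Ideal.span_le.2 fun f hf => mem_pow_idealOfVars_of_isHomogeneous (ht f hf)
  exact Ideal.span_eq_bot.2 fun f hf =>
    eq_zero_of_isHomogeneous_of_mem_pow_idealOfVars (hs f hf)
      (hpow (hst ▸ Ideal.subset_span hf)) hmn

theorem eq_of_span_eq_of_isHomogeneous {s t : Set (MvPolynomial V R)} {m n : ℕ}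
    (hs : ∀ f ∈ s, f.IsHomogeneous m) (ht : ∀ f ∈ t, f.IsHomogeneous n)
    (hst : Ideal.span s = Ideal.span t) (hne : Ideal.span s ≠ ⊥) : m = n := by
  by_contra hmn
  rcases lt_or_gt_of_ne hmn with h | h
  · exact hne (span_eq_bot_of_isHomogeneous_of_lt hs ht hst h)
  · exact hne (hst ▸ span_eq_bot_of_isHomogeneous_of_lt ht hs hst.symm h)

attribute [local instance] gradedAlgebra

theorem exists_sub_C_mul_mem_of_mem_sup {J : Ideal (MvPolynomial V R)}
    (hJ : J.IsHomogeneous (homogeneousSubmodule V R)) {f g : MvPolynomial V R} {d : ℕ}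
    (hg : g.IsHomogeneous d) (hf : f.IsHomogeneous d) (hfJ : f ∈ J ⊔ Ideal.span {g}) :
    ∃ r : R, f - C r * g ∈ J := by
  rw [sup_comm, Ideal.mem_span_singleton_sup] at hfJ
  obtain ⟨q, b, hb, rfl⟩ := hfJ
  refine ⟨constantCoeff q, ?_⟩
  have h := homogeneousComponent_mem_of_mem hJ hb d
  rwa [← add_sub_cancel_left (q * g) b, map_sub, homogeneousComponent_eq_self hf,
    homogeneousComponent_mul_of_isHomogeneous hg] at h

variable {K : Type*} [Field K] {d : ℕ} {J : Ideal (MvPolynomial V K)} {g : MvPolynomial V K}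

theorem constantCoeff_eq_zero_of_mul_mem (hJ : J.IsHomogeneous (homogeneousSubmodule V K))
    (hg : g.IsHomogeneous d) (hgJ : g ∉ J) {p : MvPolynomial V K} (hp : p * g ∈ J) :
    constantCoeff p = 0 := by
  by_contra h0
  have h := homogeneousComponent_mem_of_mem hJ hp d
  rw [homogeneousComponent_mul_of_isHomogeneous hg] at h
  exact hgJ ((Ideal.unit_mul_mem_iff_mem J ((isUnit_iff_ne_zero.2 h0).map C)).1 h)

namespace MinimalGradedFreeResolution

theorem deg_eq_of_betti_eq_zero {I : Ideal (MvPolynomial V K)} (F : MinimalGradedFreeResolution I)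
    (hF : ∀ i j, j ≠ i + d → F.betti i j = 0) (i : ℕ) (a : Fin (F.rank i)) :
    F.deg i a = i + d := by
  by_contra h
  exact Finset.filter_eq_empty_iff.1 (Finset.card_eq_zero.1 (hF i _ h)) (Finset.mem_univ a) rfl

theorem d_apply_single_isHomogeneous_one {I : Ideal (MvPolynomial V K)}
    (F : MinimalGradedFreeResolution I) (hdeg : ∀ i a, F.deg i a = i + d) (i : ℕ)
    (b : Fin (F.rank (i + 1))) (a : Fin (F.rank i)) :
    (F.d i (Pi.single b 1) a).IsHomogeneous 1 := by
  intro m hm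
  have h := F.d_homogeneous i b a m (mem_support_iff.2 hm)
  rw [hdeg, hdeg] at h
  have hm1 : m.degree = 1 := by omega
  rw [← hm1, Finsupp.degree_eq_weight_one]
  rfl

variable (F : MinimalGradedFreeResolution (J ⊔ Ideal.span {g}))

theorem exists_linearMap_aug_sub_mul_mem (hJ : J.IsHomogeneous (homogeneousSubmodule V K))
    (hg : g.IsHomogeneous d) (hdeg : ∀ a, F.deg 0 a = d) :
    ∃ φ : (Fin (F.rank 0) → MvPolynomial V K) →ₗ[MvPolynomial V K] MvPolynomial V K,
      (∀ a, (φ (Pi.single a 1)).IsHomogeneous 0) ∧ ∀ u, F.aug u - φ u * g ∈ J := by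
  have haug (a) : ∃ r : K, F.aug (Pi.single a 1) - C r * g ∈ J := by
    refine exists_sub_C_mul_mem_of_mem_sup hJ hg (hdeg a ▸ F.aug_homogeneous a) ?_
    exact F.range_aug.le (LinearMap.mem_range_self _ _)
  choose r hr using haug
  let φ := Fintype.linearCombination (MvPolynomial V K) fun a => (C (r a) : MvPolynomial V K)
  have hφ (a) : φ (Pi.single a 1) = C (r a) := by
    rw [Fintype.linearCombination_apply_single, one_smul]
  refine ⟨φ, fun a => hφ a ▸ isHomogeneous_C V (r a), fun u => ?_⟩
  have hzero : J.mkQ ∘ₗ (F.aug - φ.smulRight g) = 0 := by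
    refine (Pi.basisFun _ _).ext fun a => ?_
    rw [Pi.basisFun_apply, LinearMap.zero_apply, LinearMap.comp_apply, Submodule.mkQ_apply,
      Submodule.Quotient.mk_eq_zero, LinearMap.sub_apply, LinearMap.smulRight_apply, hφ]
    exact hr a
  exact (Submodule.Quotient.mk_eq_zero J).1 (LinearMap.congr_fun hzero u)

theorem apply_eq_zero_of_aug_eq_zero (hdeg : ∀ i a, F.deg i a = i + d)
    (hcolon : ∀ l : MvPolynomial V K, l.IsHomogeneous 1 → l * g ∈ J → l = 0)
    {φ : (Fin (F.rank 0) → MvPolynomial V K) →ₗ[MvPolynomial V K] MvPolynomial V K}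
    (hφ₀ : ∀ a, (φ (Pi.single a 1)).IsHomogeneous 0) (hφ : ∀ u, F.aug u - φ u * g ∈ J)
    {u : Fin (F.rank 0) → MvPolynomial V K} (hu : F.aug u = 0) : φ u = 0 := by
  have hker {u} (hu : F.aug u = 0) : φ u * g ∈ J := by
    simpa [hu] using hφ u
  have hd : φ ∘ₗ F.d 0 = 0 := by
    refine (Pi.basisFun _ _).ext fun b => ?_
    rw [Pi.basisFun_apply, LinearMap.comp_apply, LinearMap.zero_apply]
    refine hcolon _ ?_ (hker (F.exact_zero.apply_apply_eq_zero _))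
    rw [← (Pi.basisFun _ _).sum_repr (F.d 0 (Pi.single b 1)), map_sum]
    refine IsHomogeneous.sum _ _ _ fun a _ => ?_
    rw [map_smul, Pi.basisFun_repr, Pi.basisFun_apply, smul_eq_mul]
    exact (F.d_apply_single_isHomogeneous_one hdeg 0 b a).mul (hφ₀ a)
  obtain ⟨w, rfl⟩ := (F.exact_zero u).1 hu
  exact LinearMap.congr_fun hd w

end MinimalGradedFreeResolution

theorem exists_isHomogeneous_one_mul_mem_of_hasLinearResolution_sup
    (hJ : J.IsHomogeneous (homogeneousSubmodule V K)) (hg : g.IsHomogeneous d) (hgJ : g ∉ J)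
    {f : MvPolynomial V K} (hf : f.IsHomogeneous d) (hfJ : f ∈ J) (hf0 : f ≠ 0)
    (h : HasLinearResolution d (J ⊔ Ideal.span {g})) :
    ∃ l : MvPolynomial V K, l.IsHomogeneous 1 ∧ l * g ∈ J ∧ l ≠ 0 := by
  by_contra! hcolon
  obtain ⟨-, F, hF⟩ := h
  have hdeg := F.deg_eq_of_betti_eq_zero hF
  obtain ⟨φ, hφ₀, hφ⟩ :=
    F.exists_linearMap_aug_sub_mul_mem hJ hg fun a => (hdeg 0 a).trans (zero_add d)
  have hlift {p} (hp : p ∈ J ⊔ Ideal.span {g}) : ∃ u, F.aug u = p := F.range_aug.ge hp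
  obtain ⟨v, hv⟩ := hlift (Ideal.mem_sup_right (Ideal.mem_span_singleton_self g))
  obtain ⟨w, hw⟩ := hlift (Ideal.mem_sup_left hfJ)
  have hconst_v : constantCoeff (φ v) = 1 := by
    have h := constantCoeff_eq_zero_of_mul_mem hJ hg hgJ (p := 1 - φ v)
      (by simpa [sub_mul, hv] using hφ v)
    rwa [map_sub, map_one, sub_eq_zero, eq_comm] at h
  have hconst_w : constantCoeff (φ w) = 0 := by
    refine constantCoeff_eq_zero_of_mul_mem hJ hg hgJ ?_
    simpa [hw] using J.sub_mem hfJ (hφ w)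
  have hsyz : φ (f • v - g • w) = 0 :=
    F.apply_eq_zero_of_aug_eq_zero hdeg hcolon hφ₀ hφ (by simp [hv, hw, mul_comm])
  rw [map_sub, map_smul, map_smul, sub_eq_zero, smul_eq_mul, smul_eq_mul, mul_comm, mul_comm g]
    at hsyz
  have hcomp := congr_arg (homogeneousComponent d) hsyz
  rw [homogeneousComponent_mul_of_isHomogeneous hf, homogeneousComponent_mul_of_isHomogeneous hg,
    hconst_v, hconst_w, map_one, one_mul, map_zero, zero_mul] at hcomp
  exact hf0 hcomp

end NonlinearResolution

section EdgeIdealResolution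

variable {V : Type*} {E : Set (Finset V)}

attribute [local instance] gradedAlgebra

theorem edgeIdeal_isHomogeneous {R : Type*} [CommRing R] (E : Set (Finset V)) :
    (edgeIdeal R E).IsHomogeneous (homogeneousSubmodule V R) :=
  Ideal.homogeneous_span _ _ <| Set.forall_mem_image.2 fun F _ => ⟨_, prod_X_isHomogeneous F⟩

theorem one_lt_degree_of_mul_prod_X_mem_edgeIdeal {R : Type*} [CommRing R] [DecidableEq V]
    {G : Finset V} (hG : ∀ F ∈ E, 1 < (F \ G).card) {p : MvPolynomial V R}
    (hp : p * ∏ v ∈ G, X v ∈ edgeIdeal R E) {m : V →₀ ℕ} (hm : m ∈ p.support) : 1 < m.degree := by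
  rw [← smul_eq_mul, ← Submodule.mem_colon_singleton, edgeIdeal_colon_prod_X, mem_edgeIdeal_iff]
    at hp
  obtain ⟨_, ⟨F, hF, rfl⟩, hsub⟩ := hp m hm
  calc 1 < (F \ G).card := hG F hF
    _ ≤ m.support.card := Finset.card_le_card hsub
    _ ≤ m.degree := by
      rw [Finsupp.degree_apply, Finset.card_eq_sum_ones]
      exact Finset.sum_le_sum fun v hv =>
        Nat.one_le_iff_ne_zero.2 (Finsupp.mem_support_iff.1 hv)

variable {K : Type*} [Field K] {d : ℕ}

theorem eq_of_hasLinearResolution_edgeIdeal {e : ℕ} (hE : E.Nonempty) (hcard : ∀ F ∈ E, F.card = d)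
    (h : HasLinearResolution e (edgeIdeal K E)) : e = d := by
  obtain ⟨⟨s, hs, hspan⟩, -⟩ := h
  obtain ⟨F, hF⟩ := hE
  refine eq_of_span_eq_of_isHomogeneous hs
    (Set.forall_mem_image.2 fun F hF => hcard F hF ▸ prod_X_isHomogeneous F) hspan.symm ?_
  rw [← hspan]
  exact Submodule.ne_bot_iff _ |>.2
    ⟨_, Ideal.subset_span (Set.mem_image_of_mem _ hF), prod_X_ne_zero F⟩

theorem not_hasLinearResolution_edgeIdeal_insert [DecidableEq V] (hE : E.Nonempty) {G : Finset V}
    (hcard : ∀ F ∈ insert G E, F.card = d) (hG : ∀ F ∈ E, 1 < (F \ G).card) (e : ℕ) :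
    ¬ HasLinearResolution e (edgeIdeal K (insert G E)) := by
  intro h
  obtain rfl := eq_of_hasLinearResolution_edgeIdeal (Set.insert_nonempty G E) hcard h
  rw [edgeIdeal_insert] at h
  obtain ⟨F, hF⟩ := hE
  have hprod (A : Finset V) (hA : A ∈ insert G E) :
      (∏ v ∈ A, X v : MvPolynomial V K).IsHomogeneous e :=
    hcard A hA ▸ prod_X_isHomogeneous A
  have hGE : ∏ v ∈ G, X v ∉ edgeIdeal K E := by
    intro hmem
    rw [← one_mul (∏ v ∈ G, X v)] at hmem
    have hlt := one_lt_degree_of_mul_prod_X_mem_edgeIdeal hG hmem (m := 0) (by simp)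
    rw [map_zero] at hlt
    omega
  obtain ⟨l, hl, hlG, hl0⟩ := exists_isHomogeneous_one_mul_mem_of_hasLinearResolution_sup
    (edgeIdeal_isHomogeneous E) (hprod G (Set.mem_insert _ _)) hGE
    (hprod F (Set.mem_insert_of_mem _ hF)) (Ideal.subset_span (Set.mem_image_of_mem _ hF))
    (prod_X_ne_zero F) h
  obtain ⟨m, hm⟩ := support_nonempty.2 hl0
  have hlt := one_lt_degree_of_mul_prod_X_mem_edgeIdeal hG hlG hm
  rw [Finsupp.degree_apply, ← hl.degree_eq_sum_deg_support hm] at hlt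
  omega

end EdgeIdealResolution

namespace Clutter

theorem circuitIdeal_eq_edgeIdeal {V K : Type*} [Field K] (C : Clutter V) :
    C.circuitIdeal K = edgeIdeal K C.circuits :=
  congr_arg Ideal.span <| Set.ext fun _ => exists_congr fun _ => and_congr_right' eq_comm

theorem circuits_complement_hexahedron :
    (hexahedron.complement 3).circuits = {{0, 3, 4}, {1, 3, 4}, {2, 3, 4}, {0, 1, 2}} := by
  decide

theorem not_hasLinearResolution_circuitIdeal_complement_hexahedron {K : Type*} [Field K] (d : ℕ) :
    ¬ HasLinearResolution d ((hexahedron.complement 3).circuitIdeal K) := by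
  have hinsert : (hexahedron.complement 3).circuits =
      insert {0, 1, 2} {{0, 3, 4}, {1, 3, 4}, {2, 3, 4}} := by
    decide
  rw [circuitIdeal_eq_edgeIdeal, hinsert, Finset.coe_insert]
  refine not_hasLinearResolution_edgeIdeal_insert (d := 3) (Finset.insert_nonempty _ _) ?_ ?_ d
  · rw [← Finset.coe_insert]
    simp only [Finset.mem_coe]
    decide
  · simp only [Finset.mem_coe]
    decide

theorem hasLinearQuotients_complement_removeCircuit_hexahedron :
    ∀ F ∈ hexahedron.circuits,
      HasLinearQuotients [{0, 1, 2}, F, {2, 3, 4}, {1, 3, 4}, {0, 3, 4}] ∧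
        ((hexahedron.removeCircuit F).complement 3).circuits =
          [{0, 1, 2}, F, {2, 3, 4}, {1, 3, 4}, {0, 3, 4}].toFinset := by
  decide

theorem hasLinearResolution_circuitIdeal_complement_removeCircuit_hexahedron {K : Type*} [Field K]
    {F : Finset (Fin 5)} (hF : F ∈ hexahedron.circuits) :
    HasLinearResolution 3 (((hexahedron.removeCircuit F).complement 3).circuitIdeal K) := by
  obtain ⟨hquot, hcircuits⟩ := hasLinearQuotients_complement_removeCircuit_hexahedron F hF
  have hcard : ∀ G ∈ [{0, 1, 2}, F, {2, 3, 4}, {1, 3, 4}, {0, 3, 4}], G.card = 3 := by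
    simp [hexahedron_isUniform F hF]
  obtain ⟨resolution⟩ := hquot.nonempty_linearResolution (R := K) hcard
  rw [circuitIdeal_eq_edgeIdeal, hcircuits, List.coe_toFinset]
  exact resolution.hasLinearResolution

end Clutter

open MvPolynomial in
theorem mainTheorem8 {K : Type*} [Field K] :
    ((Clutter.hexahedron.complement 3).circuitIdeal K =
        Ideal.span ({X 0 * X 3 * X 4, X 1 * X 3 * X 4, X 2 * X 3 * X 4, X 0 * X 1 * X 2} :
          Set (MvPolynomial (Fin 5) K))) ∧
      (¬ ∃ d : ℕ, HasLinearResolution d ((Clutter.hexahedron.complement 3).circuitIdeal K)) ∧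
      ∀ F ∈ Clutter.hexahedron.circuits,
        HasLinearResolution 3
          (((Clutter.hexahedron.removeCircuit F).complement 3).circuitIdeal K) := by
  refine ⟨?_, ?_, fun F hF => ?_⟩
  · rw [Clutter.circuitIdeal_eq_edgeIdeal, Clutter.circuits_complement_hexahedron]
    simp [edgeIdeal, Set.image_insert_eq, mul_assoc]
  · rintro ⟨d, hd⟩
    exact Clutter.not_hasLinearResolution_circuitIdeal_complement_hexahedron d hd
  · exact Clutter.hasLinearResolution_circuitIdeal_complement_removeCircuit_hexahedron hF
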